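/- Let $\mathbb{F}_q$ be the finite field with $q$ elements, let $d(x,y)$ be the Hamming distance on $\mathbb{F}_q^n$, and let $C\subseteq\mathbb{F}_q^n$ be a linear code (a linear subspace) that is $(p,L)$-list-decodable, i.e. $|\{c\in C: d(w,c)\le pn\}|\le L$ for every $w\in\mathbb{F}_q^n$. Let $d_{\min}=\min\{d(c,c'): c,c'\in C,\ c\ne c'\}$ be its minimum distance ($C\neq\{0\}$), and assume that $d_{\min}\ge 4q$ and that $p-n^{-1/4}\le 1-\frac1q$. Let $D^*:\mathbb{F}_q^n\to C$ be any symmetric maximum-likelihood decoder: $D^*(z)$ is a codeword of $C$ at minimum Hamming distance from $z$, and $D^*(z+c)=D^*(z)+c$ for all $z\in\mathbb{F}_q^n$ and $c\in C$. For $p'\in[0,1]$ write $z\sim p'$ if the coordinates of the random string $z\in\mathbb{F}_q^n$ are independent and each of them equals $0$ with probability $1-p'$ and equals each given nonzero element of $\mathbb{F}_q$ with probability $\frac{p'}{q-1}$. Then for every $\delta>0$ with $p-n^{-1/4}-\delta\ge 0$ and every $c\in C$, $$\Pr_{z\sim p-n^{-1/4}-\delta}\big[D^*(c+z)=c\big]\;\ge\;1-2L\exp\Big(-\frac{1-p}{4}\cdot\frac{\sqrt{d_{\min}}}{q^{3/2}}\cdot\delta\Big).$$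 -/

import Mathlib

/-- A code `C` of length `n` is `(p, L)`-list-decodable if every Hamming ball of radius `p * n`
contains at most `L` codewords. The list size `L` may be any real number. -/
def IsListDecodable {F : Type*} [Field F] [DecidableEq F] {n : ℕ}
    (C : Submodule F (Fin n → F)) (p L : ℝ) : Prop :=
  ∀ w : Fin n → F,
    (Set.ncard {c : Fin n → F | c ∈ C ∧ (hammingDist w c : ℝ) ≤ p * n} : ℝ) ≤ L

/-- The minimum Hamming distance between two distinct codewords. The zero code has no such pair,
and then the value is `sInf ∅ = 0`, so a positive lower bound on `minDist C` forces `C ≠ 0`. -/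
noncomputable def minDist {F : Type*} [Field F] [DecidableEq F] {n : ℕ}
    (C : Submodule F (Fin n → F)) : ℕ :=
  sInf {d : ℕ | ∃ c ∈ C, ∃ c' ∈ C, c ≠ c' ∧ hammingDist c c' = d}

/-- The probability of the single string `z` under the law of a `p`-noisy string: the coordinates
are independent, each is `0` with probability `1 - p`, and each of the `q - 1` nonzero values
has probability `p / (q - 1)`. -/
noncomputable def noisyMass {F : Type*} [Field F] [Fintype F] [DecidableEq F] {n : ℕ}
    (p : ℝ) (z : Fin n → F) : ℝ :=
  ∏ i, if z i = 0 then 1 - p else p / ((Fintype.card F : ℝ) - 1)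

open Classical in
/-- The probability that a `p`-noisy string satisfies `E`. It is meant for `0 ≤ p ≤ 1`. -/
noncomputable def noisyProb {F : Type*} [Field F] [Fintype F] [DecidableEq F] {n : ℕ}
    (p : ℝ) (E : (Fin n → F) → Prop) : ℝ :=
  ∑ z with E z, noisyMass p z

/-- For `p` in `[0, 1]` the masses of the `p`-noisy strings are nonnegative and sum to one. -/
theorem noisyMass_isProbability {F : Type*} [Field F] [Fintype F] [DecidableEq F] {n : ℕ}
    (p : ℝ) (hp0 : 0 ≤ p) (hp1 : p ≤ 1) :
    (∀ z : Fin n → F, 0 ≤ noisyMass p z) ∧ ∑ z : Fin n → F, noisyMass p z = 1 := by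
  have hq : (1 : ℝ) < Fintype.card F := by exact_mod_cast Fintype.one_lt_card
  have hq' : (Fintype.card F : ℝ) - 1 ≠ 0 := by linarith
  constructor
  · intro z
    refine Finset.prod_nonneg fun i _ => ?_
    split_ifs
    · linarith
    · exact div_nonneg hp0 (by linarith)
  · have h1 : ∑ a : F, (if a = 0 then 1 - p else p / ((Fintype.card F : ℝ) - 1)) = 1 := by
      rw [← Finset.add_sum_erase _ _ (Finset.mem_univ (0 : F)),
        Finset.sum_congr rfl (g := fun _ => p / ((Fintype.card F : ℝ) - 1))
          (fun a ha => if_neg (Finset.ne_of_mem_erase ha))]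
      simp only [if_true, Finset.sum_const, Finset.card_erase_of_mem (Finset.mem_univ (0 : F)),
        Finset.card_univ, nsmul_eq_mul]
      rw [Nat.cast_sub Fintype.card_pos, Nat.cast_one]
      field_simp
      ring
    have h2 := Finset.prod_univ_sum (fun _ : Fin n => (Finset.univ : Finset F))
      (fun _ a => if a = 0 then 1 - p else p / ((Fintype.card F : ℝ) - 1))
    simp only [h1, Finset.prod_const_one, Fintype.piFinset_univ] at h2
    exact h2.symm

/-- A symmetric maximum-likelihood decoder for the `q`-ary symmetric channel: it returns a codeword
closest to the received string, and it breaks ties symmetrically, i.e. shifting the received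
string by a codeword shifts the output by that codeword (so `D z = 0` iff `D (z + c) = c`). -/
structure IsSymmetricMLDecoder {F : Type*} [Field F] [DecidableEq F] {n : ℕ}
    (C : Submodule F (Fin n → F)) (D : (Fin n → F) → C) : Prop where
  closest : ∀ (z : Fin n → F) (c : C),
    hammingDist z (D z : Fin n → F) ≤ hammingDist z (c : Fin n → F)
  symmetric : ∀ (z : Fin n → F) (c : C), D (z + (c : Fin n → F)) = D z + c

/-- Every linear code has a symmetric maximum-likelihood decoder. -/
theorem exists_isSymmetricMLDecoder {F : Type*} [Field F] [DecidableEq F] {n : ℕ}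
    (C : Submodule F (Fin n → F)) : ∃ D : (Fin n → F) → C, IsSymmetricMLDecoder C D := by
  have key : ∀ x : (Fin n → F) ⧸ C, ∃ u : Fin n → F, C.mkQ u = x ∧
      ∀ v : Fin n → F, C.mkQ v = x → hammingNorm u ≤ hammingNorm v := by
    intro x
    have hne : ({u | C.mkQ u = x} : Set (Fin n → F)).Nonempty := C.mkQ_surjective x
    exact ⟨Function.argminOn hammingNorm _ hne, Function.argminOn_mem hammingNorm _ hne,
      fun v hv => Function.argminOn_le hammingNorm _ hv⟩
  choose u hu hmin using key
  have hmem : ∀ z, z - u (C.mkQ z) ∈ C := fun z => by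
    rw [← Submodule.Quotient.mk_eq_zero, Submodule.Quotient.mk_sub, sub_eq_zero]
    exact (hu _).symm
  have hC : ∀ (z : Fin n → F) (c : C), C.mkQ (z + (c : Fin n → F)) = C.mkQ z := fun z c => by
    simp
  refine ⟨fun z => ⟨z - u (C.mkQ z), hmem z⟩, fun z c => ?_, fun z c => ?_⟩
  · have h1 := hmin (C.mkQ z) (z - (c : Fin n → F)) (by simp)
    have h2 : ∀ v : Fin n → F, hammingDist z v = hammingNorm (z - v) := fun v => by
      rw [hammingDist_comm, hammingDist_eq_hammingNorm, neg_add_eq_sub]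
    rw [h2, h2]
    simpa only [sub_sub_cancel] using h1
  · apply Subtype.ext
    simp only [hC, Submodule.coe_add]
    abel

/-! Let `f r` be the probability that noise of rate `r` lands in `strictCell C`, where zero is the
unique nearest codeword. Every symmetric maximum-likelihood decoder succeeds there, so it suffices
to bound `f` from below. Write `q` for the field size, `d` for the minimum distance and `t = p -
n^(-1/4)`.

Sharp threshold. The cell is closed under zeroing coordinates, so a Margulis–Russo inequality
(`exists_hasDerivAt_prodExpect_ind`) bounds `-f'` below by `1/(q-1)` times the mean number `h` of
exit coordinates. Linearity of the code makes `h` at least `d/q` wherever it is nonzero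
(`minDist_le_card_mul_card_exits`), whence `h ≥ √(d/q) * √h`. With the isoperimetric bound `E √h ≥
4/5 * f * (1 - f)` (`isoperimetry`) this gives `f' ≤ -(4/5) * s * f * (1 - f)`, where `s = √d /
q^(3/2)`.

Starting value. At rate `t` the weight is at most `p * n` with probability at least 1/2. Subtracting
the decoded word sends this ball into its part where zero is a nearest codeword, at most `L` to one
and without lowering the mass (`prodExpect_ball_le`), so that part has mass at least `1/(2L)`. Ties
remain possible there. Erasing each symbol with a small probability `θ` lowers the rate to `t(1-θ)`
and breaks all ties with probability at least 1/2 (`half_le_sum_erasure`), so `f (t(1-θ)) ≥ 1/(4L)`.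
Integrating the differential inequality down to `t - δ` finishes the proof. -/

/-! ### Product expectations and the isoperimetric inequality -/

/-- The expectation of `G` under the `n`-fold product of the weight `w`. -/
noncomputable def prodExpect {F : Type*} [Fintype F] {n : ℕ} (w : F → ℝ)
    (G : (Fin n → F) → ℝ) : ℝ :=
  ∑ z, (∏ i, w (z i)) * G z

open Classical in
/-- The indicator function of `A`, with real values. -/
noncomputable def ind {α : Type*} (A : Set α) (z : α) : ℝ := if z ∈ A then 1 else 0

/-- The slice of `A` over the value `a` of the first coordinate. -/
def slice {F : Type*} {n : ℕ} (A : Set (Fin (n + 1) → F)) (a : F) : Set (Fin n → F) :=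
  {y | (Fin.cons a y : Fin (n + 1) → F) ∈ A}

open Classical in
/-- The coordinates through which `z` can leave `A` by one modification. -/
noncomputable def exits {F : Type*} {n : ℕ} (A : Set (Fin n → F)) (z : Fin n → F) :
    Finset (Fin n) :=
  {i | ∃ a, Function.update z i a ∉ A}

/-- The number of coordinates through which a point of `A` can leave `A`; zero outside `A`. -/
noncomputable def innerBoundary {F : Type*} {n : ℕ} (A : Set (Fin n → F)) (z : Fin n → F) : ℝ :=
  ind A z * (exits A z).card

section

variable {F : Type*} {n : ℕ}

theorem ind_nonneg {α : Type*} (A : Set α) (z : α) : 0 ≤ ind A z := by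
  unfold ind; split_ifs <;> norm_num

theorem ind_le_one {α : Type*} (A : Set α) (z : α) : ind A z ≤ 1 := by
  unfold ind; split_ifs <;> norm_num

theorem ind_mono {α : Type*} {A B : Set α} (h : A ⊆ B) (z : α) : ind A z ≤ ind B z := by
  unfold ind
  split_ifs with h1 h2
  · exact le_rfl
  · exact absurd (h h1) h2
  · norm_num
  · exact le_rfl

theorem ind_diff {α : Type*} {A B : Set α} (h : B ⊆ A) (z : α) :
    ind (A \ B) z = ind A z - ind B z := by
  unfold ind
  by_cases hB : z ∈ B
  · simp [hB, h hB]
  · by_cases hA : z ∈ A <;> simp [hA, hB]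

theorem innerBoundary_nonneg (A : Set (Fin n → F)) (z : Fin n → F) : 0 ≤ innerBoundary A z :=
  mul_nonneg (ind_nonneg A z) (Nat.cast_nonneg _)

/-- The first coordinate is an exit exactly when the tail misses some slice; the other exits stay
inside the slice. This recursion drives both inductions on the dimension. -/
theorem innerBoundary_cons (A : Set (Fin (n + 1) → F)) (a : F) (y : Fin n → F) :
    innerBoundary A (Fin.cons a y) =
      innerBoundary (slice A a) y + ind (slice A a \ ⋂ b, slice A b) y := by
  classical
  by_cases h : (Fin.cons a y : Fin (n + 1) → F) ∈ A
  · simp only [innerBoundary, ind, h, if_true, one_mul, exits, Fin.card_filter_univ_succ,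
      Fin.update_cons_zero, ← Fin.cons_update, Set.mem_sdiff, Set.mem_iInter, true_and, not_forall,
      slice, Set.mem_ofPred_eq]
    split_ifs <;> push_cast <;> simp
  · have h' : y ∉ slice A a := h
    simp [innerBoundary, ind, h, h']

variable [Fintype F]

theorem prodExpect_succ (w : F → ℝ) (G : (Fin (n + 1) → F) → ℝ) :
    prodExpect w G = ∑ a, w a * prodExpect w fun y : Fin n → F => G (Fin.cons a y) := by
  unfold prodExpect
  rw [← (Fin.consEquiv fun _ => F).sum_comp, Fintype.sum_prod_type]
  refine Finset.sum_congr rfl fun a _ => ?_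
  rw [Finset.mul_sum]
  refine Finset.sum_congr rfl fun y _ => ?_
  simp [Fin.consEquiv, Fin.prod_univ_succ, mul_assoc]

theorem prodExpect_zero (w : F → ℝ) (G : (Fin 0 → F) → ℝ) : prodExpect w G = G default := by
  simp [prodExpect]

theorem prodExpect_mono {w : F → ℝ} (hw : ∀ a, 0 ≤ w a) {G H : (Fin n → F) → ℝ}
    (h : ∀ z, G z ≤ H z) : prodExpect w G ≤ prodExpect w H :=
  Finset.sum_le_sum fun z _ =>
    mul_le_mul_of_nonneg_left (h z) (Finset.prod_nonneg fun i _ => hw (z i))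

theorem prodExpect_add (w : F → ℝ) (G H : (Fin n → F) → ℝ) :
    (prodExpect w fun z => G z + H z) = prodExpect w G + prodExpect w H := by
  simp [prodExpect, mul_add, Finset.sum_add_distrib]

theorem prodExpect_sub (w : F → ℝ) (G H : (Fin n → F) → ℝ) :
    (prodExpect w fun z => G z - H z) = prodExpect w G - prodExpect w H := by
  simp [prodExpect, mul_sub, Finset.sum_sub_distrib]

theorem prodExpect_const_mul (w : F → ℝ) (r : ℝ) (G : (Fin n → F) → ℝ) :
    (prodExpect w fun z => r * G z) = r * prodExpect w G := by
  simp only [prodExpect, Finset.mul_sum]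
  exact Finset.sum_congr rfl fun z _ => by ring

theorem prodExpect_sum {ι : Type*} (s : Finset ι) (w : F → ℝ) (G : ι → (Fin n → F) → ℝ) :
    (prodExpect w fun z => ∑ a ∈ s, G a z) = ∑ a ∈ s, prodExpect w (G a) := by
  simp only [prodExpect, Finset.mul_sum]
  exact Finset.sum_comm

theorem prodExpect_prod (w : F → ℝ) (g : Fin n → F → ℝ) :
    (prodExpect w fun z => ∏ i, g i (z i)) = ∏ i, ∑ a, w a * g i a := by
  have h := Finset.prod_univ_sum (fun _ : Fin n => (Finset.univ : Finset F))
      (fun i a => w a * g i a)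
  simp only [Fintype.piFinset_univ] at h
  rw [h]
  simp [prodExpect, Finset.prod_mul_distrib]

theorem prodExpect_nonneg {w : F → ℝ} (hw : ∀ a, 0 ≤ w a) {G : (Fin n → F) → ℝ}
    (h : ∀ z, 0 ≤ G z) : 0 ≤ prodExpect w G :=
  Finset.sum_nonneg fun z _ => mul_nonneg (Finset.prod_nonneg fun i _ => hw (z i)) (h z)

theorem prodExpect_one {w : F → ℝ} (hw : ∑ a, w a = 1) :
    (prodExpect w fun _ : Fin n → F => (1 : ℝ)) = 1 := by
  simpa [hw] using prodExpect_prod (n := n) w fun _ _ => 1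

theorem prodExpect_ind_le_one {w : F → ℝ} (hw : ∀ a, 0 ≤ w a) (hw1 : ∑ a, w a = 1)
    (A : Set (Fin n → F)) : prodExpect w (ind A) ≤ 1 :=
  (prodExpect_mono hw fun z => ind_le_one A z).trans_eq (prodExpect_one hw1)

/-- Minkowski's inequality for the Euclidean norm of a pair of expectations. -/
theorem sqrt_sq_add_sq_prodExpect_le {w : F → ℝ} (hw : ∀ a, 0 ≤ w a) (u v : (Fin n → F) → ℝ) :
    √(prodExpect w u ^ 2 + prodExpect w v ^ 2) ≤
      prodExpect w fun z => √(u z ^ 2 + v z ^ 2) := by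
  rw [← Complex.norm_add_mul_I]
  have h : (prodExpect w u : ℂ) + prodExpect w v * Complex.I =
      ∑ z : Fin n → F, ((∏ i, w (z i) : ℝ) : ℂ) * (u z + v z * Complex.I) := by
    simp only [prodExpect, Complex.ofReal_sum, Complex.ofReal_mul, Finset.sum_mul,
      ← Finset.sum_add_distrib]
    exact Finset.sum_congr rfl fun z _ => by ring
  rw [h]
  refine (norm_sum_le _ _).trans_eq (Finset.sum_congr rfl fun z _ => ?_)
  rw [norm_mul, Complex.norm_add_mul_I, Complex.norm_real, Real.norm_of_nonneg
    (Finset.prod_nonneg fun i _ => hw (z i))]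

/-- The constant 4/5 is chosen here: after squaring, `a(1-a) ≤ 1/4` and `v² ≤ 1` reduce the claim to
`16/25 * (2 * 1/4 + 1) = 24/25 ≤ 1`. -/
theorem add_mul_sq_le_sqrt {a v U : ℝ} (ha0 : 0 ≤ a) (ha1 : a ≤ 1) (hv0 : 0 ≤ v) (hv1 : v ≤ 1)
    (hU : 4 / 5 * (a * (1 - a)) ≤ U) :
    4 / 5 * (a * (1 - a) + v ^ 2) ≤ √(U ^ 2 + v ^ 2) := by
  have hJ0 : 0 ≤ a * (1 - a) := mul_nonneg ha0 (by linarith)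
  have hJ1 : a * (1 - a) ≤ 1 / 4 := by nlinarith [sq_nonneg (a - 1 / 2)]
  apply Real.le_sqrt_of_sq_le
  generalize a * (1 - a) = J at *
  have hU2 : (4 / 5 * J) ^ 2 ≤ U ^ 2 := by gcongr
  have h1 : J * v ^ 2 ≤ 1 / 4 * v ^ 2 := by gcongr
  have h2 : v ^ 2 * v ^ 2 ≤ 1 * v ^ 2 := by
    gcongr
    nlinarith
  nlinarith [sq_nonneg v]

/-- The isoperimetric inequality in product spaces: the mean square root of the number of
coordinates through which one can leave `A` is at least of the order of the variance of `A`. -/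
theorem isoperimetry {w : F → ℝ} (hw : ∀ a, 0 ≤ w a) (hw1 : ∑ a, w a = 1) :
    ∀ {n : ℕ} (A : Set (Fin n → F)),
      4 / 5 * (prodExpect w (ind A) * (1 - prodExpect w (ind A))) ≤
        prodExpect w fun z => √(innerBoundary A z) := by
  intro n
  induction n with
  | zero =>
    intro A
    simp only [prodExpect_zero]
    refine le_trans (le_of_eq ?_) (Real.sqrt_nonneg _)
    unfold ind; split_ifs <;> norm_num
  | succ n ih =>
    intro A
    set B := ⋂ b, slice A b with hB
    have hBA : ∀ a, B ⊆ slice A a := fun a => Set.iInter_subset _ a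
    set b := prodExpect w (ind B)
    have hb0 : 0 ≤ b := prodExpect_nonneg hw (ind_nonneg B)
    set m : F → ℝ := fun a => prodExpect w (ind (slice A a)) with hm
    have hm1 : ∀ a, m a ≤ 1 := fun a => prodExpect_ind_le_one hw hw1 _
    have hbm : ∀ a, b ≤ m a := fun a => prodExpect_mono hw (ind_mono (hBA a))
    have hA : prodExpect w (ind A) = ∑ a, w a * m a := prodExpect_succ w _
    have key : ∀ a, 4 / 5 * (m a * (1 - m a) + (m a - b) ^ 2) ≤
        prodExpect w fun y => √(innerBoundary A (Fin.cons a y)) := by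
      intro a
      refine (add_mul_sq_le_sqrt (hb0.trans (hbm a)) (hm1 a) (sub_nonneg.2 (hbm a))
        (by linarith [hm1 a]) (ih (slice A a))).trans ?_
      have hv : m a - b = prodExpect w (ind (slice A a \ B)) := by
        rw [← prodExpect_sub]
        exact congrArg _ (funext fun z => (ind_diff (hBA a) z).symm)
      rw [hv]
      refine (sqrt_sq_add_sq_prodExpect_le hw _ _).trans_eq (congrArg _ (funext fun y => ?_))
      rw [innerBoundary_cons, Real.sq_sqrt (innerBoundary_nonneg _ _)]
      congr 2
      unfold ind; split_ifs <;> norm_num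
    rw [hA, prodExpect_succ w]
    refine le_trans ?_ (Finset.sum_le_sum fun a _ => mul_le_mul_of_nonneg_left (key a) (hw a))
    -- The squares of `m a` cancel, so only the mean of `m` survives. The surplus over the variance
    -- of that mean is the square of mean minus `b`.
    have hsum : ∑ a, w a * (4 / 5 * (m a * (1 - m a) + (m a - b) ^ 2)) =
        4 / 5 * ((1 - 2 * b) * ∑ a, w a * m a + b ^ 2 * ∑ a, w a) := by
      simp only [Finset.mul_sum, ← Finset.sum_add_distrib]
      exact Finset.sum_congr rfl fun a _ => by ring
    rw [hsum, hw1]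
    nlinarith [sq_nonneg (∑ a, w a * m a - b)]

end

/-! ### The q-ary symmetric channel and the Margulis–Russo inequality -/

/-- The weight of a single symbol on the `q`-ary symmetric channel with noise rate `p`. -/
noncomputable def symbolMass {F : Type*} [Field F] [Fintype F] [DecidableEq F] (p : ℝ) (a : F) :
    ℝ :=
  if a = 0 then 1 - p else p / ((Fintype.card F : ℝ) - 1)

theorem one_le_card_sub_one (F : Type*) [Field F] [Fintype F] : (1 : ℝ) ≤ (Fintype.card F : ℝ) - 1 := by
  have : (2 : ℝ) ≤ Fintype.card F := by exact_mod_cast Fintype.one_lt_card (α := F)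
  linarith

/-- A set that is closed under replacing a coordinate by zero. -/
def IsZeroClosed {F : Type*} [Field F] {n : ℕ} (A : Set (Fin n → F)) : Prop :=
  ∀ z ∈ A, ∀ i, Function.update z i 0 ∈ A

theorem IsZeroClosed.slice {F : Type*} [Field F] {n : ℕ}
    {A : Set (Fin (n + 1) → F)} (hA : IsZeroClosed A) (a : F) :
    IsZeroClosed (slice A a) := fun y hy i => by
  have := hA _ hy i.succ
  rwa [← Fin.cons_update] at this

theorem IsZeroClosed.slice_subset {F : Type*} [Field F] {n : ℕ}
    {A : Set (Fin (n + 1) → F)} (hA : IsZeroClosed A) (a : F) :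
    _root_.slice A a ⊆ _root_.slice A 0 := fun y hy => by
  have := hA _ hy 0
  rwa [Fin.update_cons_zero] at this

section

variable {F : Type*} [Field F] [Fintype F] [DecidableEq F] {n : ℕ}

theorem noisyProb_eq_prodExpect (p : ℝ) (E : (Fin n → F) → Prop) :
    noisyProb p E = prodExpect (symbolMass p) (ind {z | E z}) := by
  classical
  unfold noisyProb prodExpect noisyMass ind symbolMass
  rw [Finset.sum_filter]
  refine Finset.sum_congr rfl fun z _ => ?_
  by_cases h : E z <;> simp [h]

theorem symbolMass_nonneg {p : ℝ} (hp0 : 0 ≤ p) (hp1 : p ≤ 1) (a : F) : 0 ≤ symbolMass p a := by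
  have := one_le_card_sub_one F
  unfold symbolMass
  split_ifs
  · linarith
  · exact div_nonneg hp0 (by linarith)

theorem sum_ite_zero (x y : ℝ) :
    ∑ a : F, (if a = 0 then x else y) = x + ((Fintype.card F : ℝ) - 1) * y := by
  have h : ∀ a : F, (if a = 0 then x else y) = y + if a = 0 then x - y else 0 := fun a => by
    split_ifs <;> ring
  simp only [h, Finset.sum_add_distrib, Finset.sum_const, Finset.card_univ, nsmul_eq_mul,
    Finset.sum_ite_eq', Finset.mem_univ, if_true]
  ring

theorem sum_symbolMass (p : ℝ) : ∑ a : F, symbolMass p a = 1 := by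
  have := one_le_card_sub_one F
  unfold symbolMass
  rw [sum_ite_zero, mul_div_cancel₀ _ (by linarith)]
  ring

theorem hasDerivAt_symbolMass (t : ℝ) (a : F) :
    HasDerivAt (fun p => symbolMass p a)
      (if a = 0 then -1 else 1 / ((Fintype.card F : ℝ) - 1)) t := by
  unfold symbolMass
  split_ifs
  · simpa using (hasDerivAt_id t).const_sub 1
  · exact (hasDerivAt_id t).div_const _

/-- The contribution of the first coordinate to the derivative is `-1/(q-1)` times the sum over `a`
of the masses of `slice A 0 \ slice A a`. These differences cover `slice A 0 \ B`, which contains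
every `slice A a \ B` because zeroing stays in `A`. -/
theorem sum_deriv_symbolMass_mul_le {A : Set (Fin (n + 1) → F)} (hA : IsZeroClosed A) {t : ℝ}
    (h0 : 0 ≤ t) (h1 : t ≤ 1) :
    ∑ a : F, (if a = 0 then -1 else 1 / ((Fintype.card F : ℝ) - 1)) *
        prodExpect (symbolMass t) (ind (slice A a)) ≤
      -(1 / ((Fintype.card F : ℝ) - 1) * ∑ a, symbolMass t a *
        prodExpect (symbolMass t) (ind (slice A a \ ⋂ b, slice A b))) := by
  have hw := fun a : F => symbolMass_nonneg h0 h1 a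
  have hq := one_le_card_sub_one F
  set Q := (Fintype.card F : ℝ) - 1
  set B := ⋂ b, slice A b with hB
  set m : F → ℝ := fun a => prodExpect (symbolMass t) (ind (slice A a)) with hm
  have hU : ∑ a, symbolMass t a * prodExpect (symbolMass t) (ind (slice A a \ B)) ≤
      prodExpect (symbolMass t) (ind (slice A 0 \ B)) := by
    rw [← one_mul (prodExpect (symbolMass t) (ind (slice A 0 \ B))), ← sum_symbolMass (F := F) t,
      Finset.sum_mul]
    exact Finset.sum_le_sum fun a _ => mul_le_mul_of_nonneg_left
      (prodExpect_mono hw (ind_mono (Set.sdiff_subset_sdiff_left (hA.slice_subset a)))) (hw a)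
  have hV : prodExpect (symbolMass t) (ind (slice A 0 \ B)) ≤ ∑ a, (m 0 - m a) := by
    have h2 : ∀ a, m 0 - m a = prodExpect (symbolMass t) (ind (slice A 0 \ slice A a)) :=
      fun a => by
        rw [← prodExpect_sub]
        exact congrArg _ (funext fun z => (ind_diff (hA.slice_subset a) z).symm)
    simp only [h2]
    rw [← prodExpect_sum]
    refine prodExpect_mono hw fun z => ?_
    by_cases hz : z ∈ slice A 0 \ B
    · obtain ⟨a, ha⟩ : ∃ a, z ∉ slice A a := by simpa [hB] using hz.2
      refine le_trans ?_ (Finset.single_le_sum (fun a _ => ind_nonneg (slice A 0 \ slice A a) z)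
        (Finset.mem_univ a))
      simp [ind, hz.1, ha, hz]
    · rw [ind, if_neg hz]
      exact Finset.sum_nonneg fun a _ => ind_nonneg _ _
  have hS : ∑ a : F, (if a = 0 then -1 else 1 / Q) * m a = -(1 / Q * ∑ a, (m 0 - m a)) := by
    have h3 : ∀ a : F, (if a = 0 then -1 else 1 / Q) * m a =
        1 / Q * m a - if a = 0 then (1 + 1 / Q) * m 0 else 0 := fun a => by
      split_ifs with h
      · subst h; ring
      · ring
    simp only [h3, Finset.sum_sub_distrib, Finset.sum_ite_eq', Finset.mem_univ, if_true,
      ← Finset.mul_sum, Finset.sum_const, Finset.card_univ, nsmul_eq_mul]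
    rw [show (Fintype.card F : ℝ) = Q + 1 by simp [Q]]
    field_simp
    ring
  rw [hS]
  have : 0 ≤ 1 / Q := by positivity
  exact neg_le_neg (mul_le_mul_of_nonneg_left (hU.trans hV) this)

/-- The Margulis–Russo inequality for the `q`-ary symmetric channel. -/
theorem exists_hasDerivAt_prodExpect_ind {t : ℝ} (h0 : 0 ≤ t) (h1 : t ≤ 1) :
    ∀ {n : ℕ} {A : Set (Fin n → F)}, IsZeroClosed A →
      ∃ f', HasDerivAt (fun p => prodExpect (symbolMass p) (ind A)) f' t ∧
        f' ≤ -(1 / ((Fintype.card F : ℝ) - 1) *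
          prodExpect (symbolMass t) (innerBoundary A)) := by
  intro n
  induction n with
  | zero =>
    intro A _
    simp only [prodExpect_zero]
    exact ⟨0, hasDerivAt_const _ _, by simp [innerBoundary, exits]⟩
  | succ n ih =>
    intro A hA
    choose f' hf' hle using fun a => ih (hA.slice a)
    simp only [fun p => prodExpect_succ (symbolMass p) (ind A)]
    refine ⟨_, HasDerivAt.fun_sum fun a _ => (hasDerivAt_symbolMass t a).mul (hf' a), ?_⟩
    rw [Finset.sum_add_distrib, prodExpect_succ]
    simp only [innerBoundary_cons, prodExpect_add, mul_add, Finset.sum_add_distrib]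
    have h2 := sum_deriv_symbolMass_mul_le hA h0 h1
    have h3 := Finset.sum_le_sum fun a (_ : a ∈ Finset.univ) =>
      mul_le_mul_of_nonneg_left (hle a) (symbolMass_nonneg h0 h1 a)
    have h4 : ∑ a, symbolMass t a * -(1 / ((Fintype.card F : ℝ) - 1) *
        prodExpect (symbolMass t) (innerBoundary (slice A a))) =
        -(1 / ((Fintype.card F : ℝ) - 1) * ∑ a, symbolMass t a *
          prodExpect (symbolMass t) (innerBoundary (slice A a))) := by
      rw [Finset.mul_sum, ← Finset.sum_neg_distrib]
      exact Finset.sum_congr rfl fun a _ => by ring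
    rw [h4] at h3
    exact (add_le_add h2 h3).trans_eq (by ring)

end

/-! ### The strict cell, its boundary and the differential inequality -/

/-- The strings for which zero is the unique closest codeword. -/
def strictCell {F : Type*} [Field F] [DecidableEq F] {n : ℕ} (C : Submodule F (Fin n → F)) :
    Set (Fin n → F) :=
  {z | ∀ c ∈ C, c ≠ 0 → hammingNorm z < hammingNorm (z - c)}

theorem update_sub_eq {F : Type*} [Field F] {n : ℕ} (z c : Fin n → F) (i : Fin n) (a : F) :
    Function.update z i a - c = Function.update (z - c) i (a - c i) := by
  ext j
  by_cases h : j = i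
  · subst h; simp
  · simp [h]

section

variable {F : Type*} [Field F] [DecidableEq F] {n : ℕ}

theorem hammingNorm_update (z : Fin n → F) (i : Fin n) (a : F) :
    hammingNorm (Function.update z i a) + (if z i ≠ 0 then 1 else 0) =
      hammingNorm z + if a ≠ 0 then 1 else 0 := by
  simp only [hammingNorm, Finset.card_filter]
  rw [← Finset.add_sum_erase _ _ (Finset.mem_univ i),
    ← Finset.add_sum_erase _ (fun j => if z j ≠ 0 then 1 else 0) (Finset.mem_univ i),
    Finset.sum_congr rfl (g := fun j => if z j ≠ 0 then 1 else 0) fun j hj => by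
      rw [Function.update_of_ne (Finset.ne_of_mem_erase hj)], Function.update_self]
  ring

/-- On the support of `c`, subtracting `b • c` turns zeros of `z` into nonzeros and matches with `b
• c` into zeros; no other position changes status. -/
theorem hammingNorm_add_card_zero (z c : Fin n → F) {b : F} (hb : b ≠ 0) :
    hammingNorm z + Finset.card {j | c j ≠ 0 ∧ z j = 0} =
      hammingNorm (z - b • c) + Finset.card {j | c j ≠ 0 ∧ z j = b * c j} := by
  simp only [hammingNorm, Finset.card_filter, ← Finset.sum_add_distrib]
  refine Finset.sum_congr rfl fun j _ => ?_
  by_cases hc : c j = 0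
  · simp [hc]
  · by_cases hz : z j = 0
    · simp [hc, hz, hb]
    · by_cases h : z j = b * c j
      · simp [hc, h, hb]
      · simp [hc, hz, h, sub_eq_zero]

theorem sum_card_eq_mul [Fintype F] (z c : Fin n → F) :
    ∑ b : F, Finset.card {j | c j ≠ 0 ∧ z j = b * c j} = hammingNorm c := by
  simp only [hammingNorm, Finset.card_filter]
  rw [Finset.sum_comm]
  refine Finset.sum_congr rfl fun j _ => ?_
  by_cases hc : c j = 0
  · simp [hc]
  · simp [hc, ← div_eq_iff hc]

/-- Zeroing a nonzero symbol lowers the distance to zero by one, and the distance to any other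
codeword by at most one. -/
theorem isZeroClosed_strictCell (C : Submodule F (Fin n → F)) : IsZeroClosed (strictCell C) := by
  intro z hz i c hc hc0
  have h1 := hz c hc hc0
  have h2 := hammingNorm_update z i 0
  have h3 := hammingNorm_update (z - c) i (0 - c i)
  rw [update_sub_eq]
  by_cases hi : z i = 0
  · rw [← hi, Function.update_eq_self, ← Pi.sub_apply, Function.update_eq_self]
    exact h1
  · simp only [hi, ne_eq, not_false_eq_true, if_true, not_true_eq_false, if_false] at h2
    split_ifs at h3 <;> omega

theorem minDist_le_hammingNorm {C : Submodule F (Fin n → F)} {c : Fin n → F} (hc : c ∈ C)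
    (hc0 : c ≠ 0) : minDist C ≤ hammingNorm c :=
  Nat.sInf_le ⟨c, hc, 0, C.zero_mem, hc0, hammingDist_zero_right c⟩

theorem minDist_le (C : Submodule F (Fin n → F)) : minDist C ≤ n := by
  rcases Nat.eq_zero_or_pos (minDist C) with h | h
  · omega
  · obtain ⟨c, -, c', -, -, he⟩ := Nat.sInf_mem (Nat.nonempty_of_pos_sInf h)
    exact he.symm.le.trans (hammingDist_le_card_fintype.trans_eq (Fintype.card_fin n))

/-- A point of the strict cell which can leave it through one coordinate
can leave it through many of them. -/
theorem minDist_le_card_mul_card_exits [Fintype F] {C : Submodule F (Fin n → F)} {z : Fin n → F}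
    (hz : z ∈ strictCell C) (hne : (exits (strictCell C) z).Nonempty) :
    minDist C ≤ Fintype.card F * (exits (strictCell C) z).card := by
  classical
  obtain ⟨i, hi⟩ := hne
  obtain ⟨a, ha⟩ : ∃ a, Function.update z i a ∉ strictCell C := by simpa [exits] using hi
  obtain ⟨c, hc, hc0, hle⟩ : ∃ c ∈ C, c ≠ 0 ∧
      hammingNorm (Function.update z i a - c) ≤ hammingNorm (Function.update z i a) := by
    by_contra! h
    exact ha fun c hc hc0 => h c hc hc0
  have hzc := hz c hc hc0
  -- One modification moves each of the two distances by at most one.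
  have hclose : hammingNorm (z - c) ≤ hammingNorm z + 2 := by
    have h2 := hammingNorm_update z i a
    have h3 := hammingNorm_update (z - c) i (a - c i)
    rw [update_sub_eq] at hle
    split_ifs at h2 h3 <;> omega
  set N : F → ℕ := fun b => Finset.card {j | c j ≠ 0 ∧ z j = b * c j} with hN
  have hN0 : N 0 = Finset.card {j | c j ≠ 0 ∧ z j = 0} := by simp [hN]
  -- All multiples `b • c` are codewords farther from `z` than zero is, so zero is the most frequent
  -- ratio `z j / c j` on the support of `c`, hence occurs at least `hammingNorm c / q` times.
  have hNle : ∀ b, N b ≤ N 0 := by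
    intro b
    by_cases hb : b = 0
    · rw [hb]
    · have h1 := hammingNorm_add_card_zero z c hb
      have h2 := hz (b • c) (C.smul_mem b hc) (smul_ne_zero hb hc0)
      rw [← hN0] at h1
      change _ = _ + N b at h1
      omega
  have hsum : hammingNorm c ≤ Fintype.card F * N 0 := by
    rw [← sum_card_eq_mul z c]
    simpa using Finset.sum_le_card_nsmul Finset.univ N (N 0) fun b _ => hNle b
  refine (minDist_le_hammingNorm hc hc0).trans (hsum.trans (Nat.mul_le_mul_left _ ?_))
  rw [hN0]
  refine Finset.card_le_card fun j hj => ?_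
  obtain ⟨hcj, hzj⟩ : c j ≠ 0 ∧ z j = 0 := by simpa using hj
  simp only [exits, Finset.mem_filter, Finset.mem_univ, true_and]
  -- Replacing a zero of `z` by `c j` moves it one farther from zero and one closer to `c`, which
  -- closes a gap of at most two.
  refine ⟨c j, fun hmem => ?_⟩
  have h1 := hmem c hc hc0
  have h2 := hammingNorm_update z j (c j)
  have h3 := hammingNorm_update (z - c) j (c j - c j)
  rw [update_sub_eq] at h1
  simp [hcj, hzj] at h2 h3
  simp only [sub_self] at h1
  omega

theorem sqrt_mul_sqrt_innerBoundary_le [Fintype F] (C : Submodule F (Fin n → F))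
    (z : Fin n → F) :
    √((minDist C : ℝ) / Fintype.card F) * √(innerBoundary (strictCell C) z) ≤
      innerBoundary (strictCell C) z := by
  have hq : (0 : ℝ) < Fintype.card F := by exact_mod_cast Fintype.card_pos
  by_cases hz : z ∈ strictCell C
  · rcases (exits (strictCell C) z).eq_empty_or_nonempty with h | h
    · simp [innerBoundary, h]
    · have h1 : (minDist C : ℝ) / Fintype.card F ≤ innerBoundary (strictCell C) z := by
        rw [div_le_iff₀ hq, mul_comm, innerBoundary, ind, if_pos hz, one_mul]
        exact_mod_cast minDist_le_card_mul_card_exits hz h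
      calc _ ≤ √(innerBoundary (strictCell C) z) * √(innerBoundary (strictCell C) z) := by gcongr
        _ = _ := Real.mul_self_sqrt (innerBoundary_nonneg _ _)
  · simp [innerBoundary, ind, hz]

/-- The differential inequality for the probability of the strict cell. -/
theorem exists_hasDerivAt_strictCell [Fintype F] (C : Submodule F (Fin n → F)) {t : ℝ}
    (h0 : 0 ≤ t) (h1 : t ≤ 1) :
    ∃ f', HasDerivAt (fun p => prodExpect (symbolMass p) (ind (strictCell C))) f' t ∧
      f' ≤ -(4 / 5 * (√((minDist C : ℝ) / Fintype.card F) / Fintype.card F) *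
        (prodExpect (symbolMass t) (ind (strictCell C)) *
          (1 - prodExpect (symbolMass t) (ind (strictCell C))))) := by
  obtain ⟨f', hf', hle⟩ := exists_hasDerivAt_prodExpect_ind h0 h1 (isZeroClosed_strictCell C)
  refine ⟨f', hf', hle.trans (neg_le_neg ?_)⟩
  have hw := fun a : F => symbolMass_nonneg h0 h1 a
  have hiso := isoperimetry hw (sum_symbolMass t) (strictCell C)
  have hm := prodExpect_mono hw (sqrt_mul_sqrt_innerBoundary_le C)
  rw [prodExpect_const_mul] at hm
  have hq := one_le_card_sub_one F
  have hb : 0 ≤ prodExpect (symbolMass t) (innerBoundary (strictCell C)) :=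
    prodExpect_nonneg hw (innerBoundary_nonneg _)
  set s := √((minDist C : ℝ) / Fintype.card F)
  set μ := prodExpect (symbolMass t) (ind (strictCell C))
  calc 4 / 5 * (s / Fintype.card F) * (μ * (1 - μ))
      = 1 / (Fintype.card F : ℝ) * (s * (4 / 5 * (μ * (1 - μ)))) := by ring
    _ ≤ 1 / (Fintype.card F : ℝ) * prodExpect (symbolMass t) (innerBoundary (strictCell C)) := by
      gcongr
      exact le_trans (by gcongr) hm
    _ ≤ _ := by
      gcongr
      linarith

end

/-! ### The weak cell: list decodability and concentration of the weight -/

/-- The strings for which zero is a closest codeword. -/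
def weakCell {F : Type*} [Field F] [DecidableEq F] {n : ℕ} (C : Submodule F (Fin n → F)) :
    Set (Fin n → F) :=
  {z | ∀ c ∈ C, hammingNorm z ≤ hammingNorm (z - c)}

section

variable {F : Type*} [Field F] [Fintype F] [DecidableEq F] {n : ℕ}

theorem prod_symbolMass (p : ℝ) (z : Fin n → F) :
    ∏ i, symbolMass p (z i) =
      (1 - p) ^ (n - hammingNorm z) * (p / ((Fintype.card F : ℝ) - 1)) ^ hammingNorm z := by
  have h : Finset.card {i | z i = 0} = n - hammingNorm z := by
    have := Finset.card_filter_add_card_filter_not (s := (Finset.univ : Finset (Fin n)))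
      (fun i => z i = 0)
    rw [Finset.card_univ, Fintype.card_fin] at this
    exact Nat.eq_sub_of_add_eq this
  simp only [symbolMass, Finset.prod_ite, Finset.prod_const, h]
  rfl

/-- The bound `p ≤ 1 - 1/q` says exactly that a nonzero symbol is no likelier than zero, so lighter
strings are at least as likely. -/
theorem prod_symbolMass_le {p : ℝ} (hp0 : 0 ≤ p) (hp : p ≤ 1 - 1 / (Fintype.card F : ℝ))
    {u z : Fin n → F} (h : hammingNorm u ≤ hammingNorm z) :
    ∏ i, symbolMass p (z i) ≤ ∏ i, symbolMass p (u i) := by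
  have hq := one_le_card_sub_one F
  have hn : hammingNorm z ≤ n := hammingNorm_le_card_fintype.trans_eq (Fintype.card_fin n)
  rw [prod_symbolMass, prod_symbolMass]
  have hβ : 0 ≤ p / ((Fintype.card F : ℝ) - 1) := by positivity
  have hαβ : p / ((Fintype.card F : ℝ) - 1) ≤ 1 - p := by
    rw [div_le_iff₀ (by linarith)]
    rw [le_sub_iff_add_le, ← le_sub_iff_add_le', div_le_iff₀ (by linarith)] at hp
    linarith
  set β := p / ((Fintype.card F : ℝ) - 1)
  obtain ⟨k, hk⟩ := Nat.exists_eq_add_of_le h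
  obtain ⟨l, hl⟩ := Nat.exists_eq_add_of_le hn
  have h1 : n - hammingNorm z = l := by omega
  have h2 : n - hammingNorm u = l + k := by omega
  rw [h1, h2, hk, pow_add, pow_add, mul_assoc, mul_comm (β ^ hammingNorm u)]
  have : 0 ≤ 1 - p := hβ.trans hαβ
  gcongr

/-- The strings of weight at most `p * n` are covered by translates of those among them for which
zero is a closest codeword. -/
theorem prodExpect_ball_le {C : Submodule F (Fin n → F)} {p L : ℝ} (hlist : IsListDecodable C p L)
    {D : (Fin n → F) → C} (hD : IsSymmetricMLDecoder C D) {t : ℝ} (ht0 : 0 ≤ t)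
    (ht : t ≤ 1 - 1 / (Fintype.card F : ℝ)) :
    prodExpect (symbolMass t) (ind {z : Fin n → F | (hammingNorm z : ℝ) ≤ p * n}) ≤
      L * prodExpect (symbolMass t)
        (ind {z : Fin n → F | z ∈ weakCell C ∧ (hammingNorm z : ℝ) ≤ p * n}) := by
  classical
  have hdist : ∀ z c : Fin n → F, hammingDist z c = hammingNorm (z - c) := fun z c => by
    rw [hammingDist_comm, hammingDist_eq_hammingNorm, neg_add_eq_sub]
  have hmin : ∀ (z : Fin n → F), ∀ c ∈ C,
      hammingNorm (z - (D z : Fin n → F)) ≤ hammingNorm (z - c) := fun z c hc => by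
    have := hD.closest z ⟨c, hc⟩
    rwa [hdist, hdist] at this
  simp only [prodExpect, ind, mul_ite, mul_one, mul_zero, ← Finset.sum_filter, Set.mem_ofPred_eq]
  set S : Finset (Fin n → F) := {z | (hammingNorm z : ℝ) ≤ p * n} with hS
  set T : Finset (Fin n → F) := {z | z ∈ weakCell C ∧ (hammingNorm z : ℝ) ≤ p * n} with hT
  have hmaps : ∀ z ∈ S, z - (D z : Fin n → F) ∈ T := by
    intro z hz
    simp only [hS, hT, Finset.mem_filter, Finset.mem_univ, true_and] at hz ⊢
    refine ⟨fun c hc => ?_, ?_⟩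
    · rw [sub_sub]
      exact hmin z _ (C.add_mem (D z).2 hc)
    · have h1 := hmin z 0 C.zero_mem
      rw [sub_zero] at h1
      exact le_trans (by exact_mod_cast h1) hz
  have hle : ∑ z ∈ S, ∏ i, symbolMass t (z i) ≤
      ∑ z ∈ S, ∏ i, symbolMass t ((z - (D z : Fin n → F)) i) :=
    Finset.sum_le_sum fun z _ => prod_symbolMass_le ht0 ht (by simpa using hmin z 0 C.zero_mem)
  refine hle.trans ?_
  rw [← Finset.sum_fiberwise_of_maps_to hmaps, Finset.mul_sum]
  refine Finset.sum_le_sum fun u _ => ?_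
  rw [Finset.sum_congr rfl (g := fun _ => ∏ i, symbolMass t (u i)) fun z hz => by
    rw [(Finset.mem_filter.1 hz).2], Finset.sum_const, nsmul_eq_mul]
  have ht1 : t ≤ 1 := ht.trans (by simp)
  refine mul_le_mul_of_nonneg_right ?_
    (Finset.prod_nonneg fun i _ => symbolMass_nonneg ht0 ht1 (u i))
  -- A point `z` of the fibre over `u` yields the codeword `u - z`, whose distance from `u` is the
  -- weight of `z`.
  refine le_trans ?_ (hlist u)
  rw [← Set.ncard_coe_finset]
  refine Nat.cast_le.2 (Set.ncard_le_ncard_of_injOn (fun z => u - z) ?_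
    (sub_right_injective.injOn) (Set.toFinite _))
  intro z hz
  have hz' : z ∈ S ∧ z - (D z : Fin n → F) = u := by simpa using hz
  refine ⟨?_, ?_⟩
  · rw [← hz'.2, sub_sub_cancel_left]
    exact C.neg_mem (D z).2
  · rw [hdist, sub_sub_cancel]
    simpa [hS] using hz'.1

/-- A Chernoff bound for the weight of a noisy string. -/
theorem half_le_prodExpect_ball {t x : ℝ} (ht0 : 0 ≤ t) (ht1 : t ≤ 1) (hx0 : 0 < x) (hx1 : x ≤ 1)
    (hx : n * x ^ 4 = 1) (hn : 8 ≤ n) :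
    1 / 2 ≤ prodExpect (symbolMass t)
      (ind {z : Fin n → F | (hammingNorm z : ℝ) ≤ (t + x) * n}) := by
  have hw := fun a : F => symbolMass_nonneg ht0 ht1 a
  set S := {z : Fin n → F | (hammingNorm z : ℝ) ≤ (t + x) * n} with hS
  have hpt : ∀ z : Fin n → F, 1 - Real.exp (-(x / 2 * ((t + x) * n))) *
      ∏ i, (if z i = 0 then 1 else Real.exp (x / 2)) ≤ ind S z := by
    intro z
    have hprod : ∏ i, (if z i = 0 then 1 else Real.exp (x / 2)) =
        Real.exp (x / 2 * hammingNorm z) := by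
      rw [Finset.prod_ite, Finset.prod_const_one, one_mul, Finset.prod_const, mul_comm,
        Real.exp_nat_mul]
      rfl
    rw [hprod, ← Real.exp_add]
    by_cases hz : z ∈ S
    · rw [ind, if_pos hz]
      linarith [Real.exp_pos (-(x / 2 * ((t + x) * n)) + x / 2 * hammingNorm z)]
    · rw [ind, if_neg hz, sub_nonpos, Real.one_le_exp_iff]
      have : (t + x) * n < hammingNorm z := by simpa [hS] using hz
      nlinarith
  refine le_trans ?_ (prodExpect_mono hw hpt)
  rw [prodExpect_sub, prodExpect_one (sum_symbolMass t), prodExpect_const_mul,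
    prodExpect_prod (symbolMass t) fun _ a => if a = 0 then 1 else Real.exp (x / 2)]
  have hsum : ∑ a : F, symbolMass t a * (if a = 0 then 1 else Real.exp (x / 2)) =
      1 + t * (Real.exp (x / 2) - 1) := by
    have hq := one_le_card_sub_one F
    have h : ∀ a : F, symbolMass t a * (if a = 0 then 1 else Real.exp (x / 2)) =
        if a = 0 then 1 - t else t / ((Fintype.card F : ℝ) - 1) * Real.exp (x / 2) := fun a => by
      unfold symbolMass; split_ifs <;> simp
    simp only [h]
    rw [sum_ite_zero]
    field_simp
    ring
  rw [hsum, Finset.prod_const, Finset.card_univ, Fintype.card_fin]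
  have hexp : Real.exp (x / 2) - 1 ≤ x / 2 + (x / 2) ^ 2 := by
    have h := Real.abs_exp_sub_one_sub_id_le (x := x / 2) (by rw [abs_of_pos] <;> linarith)
    linarith [(abs_le.1 h).2]
  have h1 : 1 + t * (Real.exp (x / 2) - 1) ≤ Real.exp (t * (x / 2) + (x / 2) ^ 2) := by
    refine le_trans ?_ (Real.add_one_le_exp _)
    nlinarith [mul_le_mul_of_nonneg_left hexp ht0, sq_nonneg (x / 2)]
  have h2 : 0 ≤ 1 + t * (Real.exp (x / 2) - 1) := by
    have : 1 ≤ Real.exp (x / 2) := Real.one_le_exp_iff.2 (by linarith)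
    nlinarith
  have h3 : Real.exp (-(x / 2 * ((t + x) * n))) * (1 + t * (Real.exp (x / 2) - 1)) ^ n ≤
      Real.exp (-(n * x ^ 2 / 4)) := by
    calc _ ≤ Real.exp (-(x / 2 * ((t + x) * n))) *
          Real.exp (t * (x / 2) + (x / 2) ^ 2) ^ n := by gcongr
      _ = _ := by
        rw [← Real.exp_nat_mul, ← Real.exp_add]
        congr 1
        ring
  -- The exponent is `√n / 4`; for `n ≥ 8` it is at least `0.7`, just above `log 2`.
  have h4 : Real.exp (-(n * x ^ 2 / 4)) ≤ 1 / 2 := by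
    rw [← Real.le_log_iff_exp_le (by norm_num), one_div, Real.log_inv]
    have h8 : (8 : ℝ) ≤ n := by exact_mod_cast hn
    have hy : (n * x ^ 2) ^ 2 = (n : ℝ) := by
      calc (n * x ^ 2) ^ 2 = (n : ℝ) * (n * x ^ 4) := by ring
        _ = (n : ℝ) := by rw [hx, mul_one]
    have hy' : (2.8 : ℝ) ≤ n * x ^ 2 := by
      have h0 : 0 ≤ n * x ^ 2 := by positivity
      nlinarith
    linarith [Real.log_two_lt_d9]
  linarith

end

/-! ### Breaking ties by random erasures -/

/-- The transition kernel on symbols that replaces a symbol by zero with probability `θ`. -/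
noncomputable def erasure {F : Type*} [Field F] [DecidableEq F] (θ : ℝ) (a b : F) : ℝ :=
  (if b = a then 1 - θ else 0) + if b = 0 then θ else 0

theorem sum_prod_apply {F : Type*} [Fintype F] {n : ℕ} (h : Fin n → F → ℝ) :
    ∑ y : Fin n → F, ∏ i, h i (y i) = ∏ i, ∑ b, h i b := by
  have := Finset.prod_univ_sum (fun _ : Fin n => (Finset.univ : Finset F)) h
  simpa only [Fintype.piFinset_univ] using this.symm

section

variable {F : Type*} [Field F] [DecidableEq F] {n : ℕ}

theorem erasure_nonneg {θ : ℝ} (h0 : 0 ≤ θ) (h1 : θ ≤ 1) (a b : F) : 0 ≤ erasure θ a b := by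
  unfold erasure
  split_ifs <;> linarith

theorem erasure_eq_zero {θ : ℝ} {a b : F} (ha : b ≠ a) (h0 : b ≠ 0) : erasure θ a b = 0 := by
  simp [erasure, ha, h0]

/-- If some symbols of `z` are erased and `c` still beats zero, then no symbol on the support of
`c` was erased and `c` was already as close to `z` as zero. -/
theorem tie_of_erased {z y c : Fin n → F} (hy : ∀ i, y i = z i ∨ y i = 0)
    (hz : hammingNorm z ≤ hammingNorm (z - c)) (hyc : hammingNorm (y - c) ≤ hammingNorm y) :
    hammingNorm (z - c) = hammingNorm z ∧ ∀ j, c j ≠ 0 → y j = z j := by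
  set f : Fin n → ℕ := fun j => (if y j ≠ 0 then 1 else 0) + if z j - c j ≠ 0 then 1 else 0
  set g : Fin n → ℕ := fun j => (if z j ≠ 0 then 1 else 0) + if y j - c j ≠ 0 then 1 else 0
  have hf : ∑ j, f j = hammingNorm y + hammingNorm (z - c) := by
    simp only [f, hammingNorm, Finset.card_filter, Finset.sum_add_distrib, Pi.sub_apply]
  have hg : ∑ j, g j = hammingNorm z + hammingNorm (y - c) := by
    simp only [g, hammingNorm, Finset.card_filter, Finset.sum_add_distrib, Pi.sub_apply]
  -- Coordinatewise, an erasure never diminishes the advantage of zero over `c`, and it raises it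
  -- strictly on the support of `c`.
  have hfg : ∀ j, f j ≤ g j := by
    intro j
    simp only [f, g]
    rcases hy j with h | h
    · rw [h]
    · rw [h]
      by_cases hc : c j = 0
      · simp [hc]
      · by_cases hzj : z j = 0
        · simp [hzj]
        · simp only [ne_eq, not_true_eq_false, if_false, hzj, not_false_eq_true, if_true, zero_sub,
            neg_eq_zero, hc]
          split_ifs <;> norm_num
  have hsum : ∑ j, f j ≤ ∑ j, g j := Finset.sum_le_sum fun j _ => hfg j
  refine ⟨by omega, fun j hc => ?_⟩
  by_contra hne
  have hlt : f j < g j := by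
    have h0 : y j = 0 := (hy j).resolve_left hne
    have hzj : z j ≠ 0 := fun h => hne (by rw [h0, h])
    simp only [f, g, h0, ne_eq, not_true_eq_false, if_false, hzj, not_false_eq_true,
      if_true, zero_sub, neg_eq_zero, hc]
    split_ifs <;> norm_num
  have := Finset.sum_lt_sum (fun j _ => hfg j) ⟨j, Finset.mem_univ j, hlt⟩
  omega

/-- In a tie, `z` has as many zeros on the support of `c` as agreements with `c` there, and the
agreements are nonzero symbols. -/
theorem hammingNorm_le_two_mul_card {z c : Fin n → F} (h : hammingNorm (z - c) = hammingNorm z) :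
    hammingNorm c ≤ 2 * Finset.card {j | c j ≠ 0 ∧ z j ≠ 0} := by
  have h1 := hammingNorm_add_card_zero z c one_ne_zero
  rw [one_smul, h] at h1
  have h2 : Finset.card {j | c j ≠ 0 ∧ z j = 1 * c j} ≤ Finset.card {j | c j ≠ 0 ∧ z j ≠ 0} := by
    refine Finset.card_le_card fun j hj => ?_
    simp only [Finset.mem_filter, Finset.mem_univ, true_and, one_mul] at hj ⊢
    exact ⟨hj.1, hj.2 ▸ hj.1⟩
  have h3 : hammingNorm c =
      Finset.card {j | c j ≠ 0 ∧ z j = 0} + Finset.card {j | c j ≠ 0 ∧ z j ≠ 0} := by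
    rw [← Finset.filter_filter, ← Finset.filter_filter, Finset.card_filter_add_card_filter_not]
    rfl
  omega

variable [Fintype F]

theorem sum_erasure (θ : ℝ) (a : F) : ∑ b, erasure θ a b = 1 := by
  simp [erasure, Finset.sum_add_distrib]

theorem sum_symbolMass_mul_erasure (p θ : ℝ) (b : F) :
    ∑ a, symbolMass p a * erasure θ a b = symbolMass (p * (1 - θ)) b := by
  simp only [erasure, mul_add, Finset.sum_add_distrib, ← Finset.sum_mul, sum_symbolMass, one_mul]
  simp only [mul_ite, mul_zero, Finset.sum_ite_eq, Finset.mem_univ, if_true]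
  unfold symbolMass
  split_ifs <;> ring

theorem prodExpect_symbolMass_mul (p θ : ℝ) (G : (Fin n → F) → ℝ) :
    prodExpect (symbolMass (p * (1 - θ))) G =
      prodExpect (symbolMass p) fun z => ∑ y, (∏ i, erasure θ (z i) (y i)) * G y := by
  rw [prodExpect_sum]
  refine Finset.sum_congr rfl fun y _ => ?_
  simp only [← sum_symbolMass_mul_erasure]
  rw [← prodExpect_prod (symbolMass p) fun i a => erasure θ a (y i), mul_comm,
    ← prodExpect_const_mul]
  simp only [mul_comm]

/-- The probability that no nonzero symbol of `z` on the support of `c` is erased. -/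
theorem sum_erasure_agree_le {θ : ℝ} (h0 : 0 ≤ θ) (h1 : θ ≤ 1) (z c : Fin n → F) :
    ∑ y : Fin n → F, (∏ i, erasure θ (z i) (y i)) * ind {y | ∀ j, c j ≠ 0 → y j = z j} y ≤
      (1 - θ) ^ Finset.card {j | c j ≠ 0 ∧ z j ≠ 0} := by
  classical
  have h : ∀ y : Fin n → F, (∏ i, erasure θ (z i) (y i)) * ind {y | ∀ j, c j ≠ 0 → y j = z j} y =
      ∏ i, erasure θ (z i) (y i) * if c i ≠ 0 → y i = z i then 1 else 0 := fun y => by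
    rw [Finset.prod_mul_distrib, Finset.prod_ite_zero]
    simp [ind]
  simp only [h]
  rw [sum_prod_apply fun i b => erasure θ (z i) b * if c i ≠ 0 → b = z i then 1 else 0]
  have hR : (1 - θ) ^ Finset.card {j | c j ≠ 0 ∧ z j ≠ 0} =
      ∏ j, if c j ≠ 0 ∧ z j ≠ 0 then 1 - θ else 1 := by
    rw [Finset.prod_ite, Finset.prod_const_one, mul_one, Finset.prod_const]
  rw [hR]
  refine Finset.prod_le_prod (fun i _ => Finset.sum_nonneg fun b _ => mul_nonneg
    (erasure_nonneg h0 h1 _ _) (by split_ifs <;> norm_num)) fun i _ => ?_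
  split_ifs with hi
  · obtain ⟨hc, hz⟩ := hi
    simp [hc, erasure, hz]
  · refine (Finset.sum_le_sum fun b _ => ?_).trans_eq (sum_erasure θ (z i))
    exact mul_le_of_le_one_right (erasure_nonneg h0 h1 _ _) (by split_ifs <;> norm_num)

/-- Erasing symbols of a string with few closest codewords breaks all ties
with probability at least one half. -/
theorem half_le_sum_erasure {C : Submodule F (Fin n → F)} {p L : ℝ}
    (hlist : IsListDecodable C p L) (hL : 1 ≤ L) {θ : ℝ} (h0 : 0 ≤ θ) (h1 : θ ≤ 1)
    (hθ : 2 * Real.log (2 * L) ≤ θ * minDist C) {z : Fin n → F} (hz : z ∈ weakCell C)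
    (hzp : (hammingNorm z : ℝ) ≤ p * n) :
    1 / 2 ≤ ∑ y, (∏ i, erasure θ (z i) (y i)) * ind (strictCell C) y := by
  classical
  set T : Finset (Fin n → F) := {c | c ∈ C ∧ c ≠ 0 ∧ hammingNorm (z - c) = hammingNorm z} with hT
  have hcard : (T.card : ℝ) ≤ L := by
    refine le_trans ?_ (hlist z)
    rw [← Set.ncard_coe_finset]
    refine Nat.cast_le.2 (Set.ncard_le_ncard (fun c hc => ?_) (Set.toFinite _))
    have hc' : c ∈ C ∧ c ≠ 0 ∧ hammingNorm (z - c) = hammingNorm z := by simpa [hT] using hc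
    refine ⟨hc'.1, ?_⟩
    rw [hammingDist_comm, hammingDist_eq_hammingNorm, neg_add_eq_sub, hc'.2.2]
    exact hzp
  have hterm : ∀ c ∈ T,
      ∑ y : Fin n → F, (∏ i, erasure θ (z i) (y i)) * ind {y | ∀ j, c j ≠ 0 → y j = z j} y ≤
        1 / (2 * L) := by
    intro c hc
    have hc' : c ∈ C ∧ c ≠ 0 ∧ hammingNorm (z - c) = hammingNorm z := by simpa [hT] using hc
    refine (sum_erasure_agree_le h0 h1 z c).trans ?_
    have hM : minDist C ≤ 2 * Finset.card {j | c j ≠ 0 ∧ z j ≠ 0} :=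
      (minDist_le_hammingNorm hc'.1 hc'.2.1).trans (hammingNorm_le_two_mul_card hc'.2.2)
    set M := Finset.card {j | c j ≠ 0 ∧ z j ≠ 0}
    have hM' : (minDist C : ℝ) ≤ 2 * M := by exact_mod_cast hM
    calc (1 - θ) ^ M ≤ Real.exp (-θ) ^ M := by
          gcongr
          linarith [Real.add_one_le_exp (-θ)]
      _ = Real.exp (-(θ * M)) := by rw [← Real.exp_nat_mul]; congr 1; ring
      _ ≤ Real.exp (-Real.log (2 * L)) := by
          gcongr
          nlinarith [mul_le_mul_of_nonneg_left hM' h0]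
      _ = 1 / (2 * L) := by rw [Real.exp_neg, Real.exp_log (by linarith), one_div]
  -- Union bound: if `y` leaves the strict cell, some codeword tied at `z` had no symbol erased on
  -- its support.
  have hpt : ∀ y : Fin n → F, (∏ i, erasure θ (z i) (y i)) *
      (1 - ∑ c ∈ T, ind {y | ∀ j, c j ≠ 0 → y j = z j} y) ≤
        (∏ i, erasure θ (z i) (y i)) * ind (strictCell C) y := by
    intro y
    by_cases hy : ∀ i, y i = z i ∨ y i = 0
    · refine mul_le_mul_of_nonneg_left ?_
        (Finset.prod_nonneg fun i _ => erasure_nonneg h0 h1 _ _)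
      have hnn : ∀ c ∈ T, 0 ≤ ind {y | ∀ j, c j ≠ 0 → y j = z j} y := fun c _ => ind_nonneg _ _
      by_cases hs : y ∈ strictCell C
      · rw [ind, if_pos hs]
        linarith [Finset.sum_nonneg hnn]
      · obtain ⟨c, hc, hc0, hle⟩ : ∃ c ∈ C, c ≠ 0 ∧ hammingNorm (y - c) ≤ hammingNorm y := by
          by_contra! h
          exact hs fun c hc hc0 => h c hc hc0
        obtain ⟨hcz, hag⟩ := tie_of_erased hy (hz c hc) hle
        have hcT : c ∈ T := by simp [hT, hc, hc0, hcz]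
        have h2 := Finset.single_le_sum hnn hcT
        have h3 : ind {y | ∀ j, c j ≠ 0 → y j = z j} y = 1 := by
          rw [ind, if_pos]
          exact hag
        rw [h3] at h2
        linarith [ind_nonneg (strictCell C) y]
    · push Not at hy
      obtain ⟨i, hi1, hi2⟩ := hy
      have h2 : ∏ i, erasure θ (z i) (y i) = 0 :=
        Finset.prod_eq_zero (Finset.mem_univ i) (erasure_eq_zero hi1 hi2)
      rw [h2, zero_mul, zero_mul]
  refine le_trans ?_ (Finset.sum_le_sum fun y _ => hpt y)
  simp only [mul_sub, mul_one, Finset.sum_sub_distrib, Finset.mul_sum]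
  rw [sum_prod_apply fun i b => erasure θ (z i) b, Finset.sum_comm]
  simp only [sum_erasure, Finset.prod_const_one]
  have h4 := Finset.sum_le_card_nsmul T _ _ hterm
  rw [nsmul_eq_mul] at h4
  have h5 : (T.card : ℝ) * (1 / (2 * L)) ≤ L * (1 / (2 * L)) := by gcongr
  have h6 : L * (1 / (2 * L)) = 1 / 2 := by field_simp
  linarith

/-- A lower bound for the probability of the strict cell at a slightly reduced noise rate. -/
theorem half_mul_le_prodExpect_strictCell {C : Submodule F (Fin n → F)} {p L : ℝ}
    (hlist : IsListDecodable C p L) (hL : 1 ≤ L) {θ : ℝ} (h0 : 0 ≤ θ) (h1 : θ ≤ 1)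
    (hθ : 2 * Real.log (2 * L) ≤ θ * minDist C) {t : ℝ} (ht0 : 0 ≤ t) (ht1 : t ≤ 1) :
    1 / 2 * prodExpect (symbolMass t)
        (ind {z : Fin n → F | z ∈ weakCell C ∧ (hammingNorm z : ℝ) ≤ p * n}) ≤
      prodExpect (symbolMass (t * (1 - θ))) (ind (strictCell C)) := by
  rw [prodExpect_symbolMass_mul, ← prodExpect_const_mul]
  refine prodExpect_mono (symbolMass_nonneg ht0 ht1) fun z => ?_
  by_cases hz : z ∈ weakCell C ∧ (hammingNorm z : ℝ) ≤ p * n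
  · refine le_trans ?_ (half_le_sum_erasure hlist hL h0 h1 hθ hz.1 hz.2)
    linarith [ind_le_one {z : Fin n → F | z ∈ weakCell C ∧ (hammingNorm z : ℝ) ≤ p * n} z]
  · rw [ind, if_neg (by exact hz), mul_zero]
    exact Finset.sum_nonneg fun y _ => mul_nonneg
      (Finset.prod_nonneg fun i _ => erasure_nonneg h0 h1 _ _) (ind_nonneg _ _)

end

/-! ### Integrating the logistic inequality and the final estimate -/

/-- A function that decreases at least logistically is close to one at the left endpoint. -/
theorem one_sub_le_of_logistic {f : ℝ → ℝ} {κ a b : ℝ} (hab : a ≤ b) (hκ : 0 ≤ κ)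
    (hf : ∀ t ∈ Set.Icc a b, ∃ f', HasDerivAt f f' t ∧ f' ≤ -(κ * (f t * (1 - f t))))
    (h0 : ∀ t ∈ Set.Icc a b, 0 ≤ f t) (h1 : ∀ t ∈ Set.Icc a b, f t ≤ 1) (hb : 0 < f b) :
    1 - f a ≤ 1 / f b * Real.exp (-(κ * (b - a))) := by
  choose! f' hf' hle using hf
  have hanti : AntitoneOn f (Set.Icc a b) := by
    refine antitoneOn_of_hasDerivWithinAt_nonpos (f' := f') (convex_Icc a b)
      (fun t ht => (hf' t ht).continuousAt.continuousWithinAt)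
      (fun t ht => (hf' t (interior_subset ht)).hasDerivWithinAt) fun t ht => ?_
    have ht' := interior_subset ht
    have := mul_nonneg hκ (mul_nonneg (h0 t ht') (sub_nonneg.2 (h1 t ht')))
    linarith [hle t ht']
  have hpos : ∀ t ∈ Set.Icc a b, 0 < f t := fun t ht =>
    hb.trans_le (hanti ht (Set.right_mem_Icc.2 hab) ht.2)
  -- For an exact logistic solution this is constant; here it is nondecreasing.
  set G : ℝ → ℝ := fun t => ((f t)⁻¹ - 1) * Real.exp (-κ * t) with hG
  have hG' : ∀ t ∈ Set.Icc a b, HasDerivAt G (-f' t / f t ^ 2 * Real.exp (-κ * t) +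
      ((f t)⁻¹ - 1) * (Real.exp (-κ * t) * (-κ * 1))) t := fun t ht =>
    (((hf' t ht).fun_inv (hpos t ht).ne').sub_const 1).mul
      (((hasDerivAt_id t).const_mul (-κ)).exp)
  have hmono : MonotoneOn G (Set.Icc a b) := by
    refine monotoneOn_of_hasDerivWithinAt_nonneg (convex_Icc a b)
      (fun t ht => (hG' t ht).continuousAt.continuousWithinAt)
      (fun t ht => (hG' t (interior_subset ht)).hasDerivWithinAt) fun t ht => ?_
    have ht' := interior_subset ht
    have hp := hpos t ht'
    have h2 : κ * ((f t)⁻¹ - 1) ≤ -f' t / f t ^ 2 := by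
      rw [le_div_iff₀ (by positivity)]
      have : κ * ((f t)⁻¹ - 1) * f t ^ 2 = κ * (f t * (1 - f t)) := by
        field_simp
      linarith [hle t ht']
    have h3 := mul_le_mul_of_nonneg_right h2 (Real.exp_pos (-κ * t)).le
    linarith
  have hGab := hmono (Set.left_mem_Icc.2 hab) (Set.right_mem_Icc.2 hab) hab
  have ha := hpos a (Set.left_mem_Icc.2 hab)
  have ha1 := h1 a (Set.left_mem_Icc.2 hab)
  have h4 : 1 - f a ≤ (f a)⁻¹ - 1 := by
    have : 0 ≤ (1 - f a) ^ 2 / f a := by positivity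
    have h5 : (1 - f a) ^ 2 / f a = (f a)⁻¹ - 1 - (1 - f a) := by
      field_simp
    linarith
  have h6 : ((f a)⁻¹ - 1) * Real.exp (-κ * a) ≤ (f b)⁻¹ * Real.exp (-κ * b) := by
    refine hGab.trans ?_
    simp only [hG]
    gcongr
    linarith
  have h7 : (f a)⁻¹ - 1 ≤ (f b)⁻¹ * Real.exp (-(κ * (b - a))) := by
    have h8 : Real.exp (-(κ * (b - a))) * Real.exp (-κ * a) = Real.exp (-κ * b) := by
      rw [← Real.exp_add]
      congr 1
      ring
    rw [← h8, ← mul_assoc] at h6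
    exact le_of_mul_le_mul_right h6 (Real.exp_pos _)
  rw [one_div]
  exact h4.trans h7

section

variable {F : Type*} [Field F] [DecidableEq F] {n : ℕ}

theorem IsSymmetricMLDecoder.apply_add_eq {C : Submodule F (Fin n → F)} {D : (Fin n → F) → C}
    (hD : IsSymmetricMLDecoder C D) {z : Fin n → F} (hz : z ∈ strictCell C) (c : C) :
    D ((c : Fin n → F) + z) = c := by
  have h0 : D z = 0 := by
    by_contra h
    have h1 := hD.closest z 0
    have h2 := hz (D z) (D z).2 (by simpa using h)
    rw [hammingDist_comm, hammingDist_eq_hammingNorm, neg_add_eq_sub] at h1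
    simp only [ZeroMemClass.coe_zero, hammingDist_zero_right] at h1
    omega
  rw [add_comm, hD.symmetric, h0, zero_add]

theorem IsListDecodable.one_le [Finite F] {C : Submodule F (Fin n → F)} {p L : ℝ}
    (hlist : IsListDecodable C p L) (hp : 0 ≤ p) : 1 ≤ L := by
  refine le_trans ?_ (hlist 0)
  rw [Nat.one_le_cast, Nat.succ_le_iff, Set.ncard_pos]
  exact ⟨0, C.zero_mem, by simpa using mul_nonneg hp (Nat.cast_nonneg n)⟩

end

theorem theorem3 {F : Type*} [Field F] [Fintype F] [DecidableEq F] {n : ℕ}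
    (C : Submodule F (Fin n → F)) (p L : ℝ)
    (hlist : IsListDecodable C p L)
    (hdist : 4 * Fintype.card F ≤ minDist C)
    (hp : p - (n : ℝ) ^ (-(1 / 4) : ℝ) ≤ 1 - 1 / (Fintype.card F : ℝ))
    (D : (Fin n → F) → C) (hD : IsSymmetricMLDecoder C D)
    (δ : ℝ) (hδ : 0 < δ) (hnoise : 0 ≤ p - (n : ℝ) ^ (-(1 / 4) : ℝ) - δ) (c : C) :
    1 - 2 * L * Real.exp (-((1 - p) / 4 *
        (Real.sqrt (minDist C) / (Fintype.card F : ℝ) ^ (3 / 2 : ℝ)) * δ)) ≤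
      noisyProb (p - (n : ℝ) ^ (-(1 / 4) : ℝ) - δ) (fun z => D ((c : Fin n → F) + z) = c) := by
  have hq2 : 2 ≤ Fintype.card F := Fintype.one_lt_card
  have hq2' : (2 : ℝ) ≤ Fintype.card F := by exact_mod_cast hq2
  have hn8 : 8 ≤ n := by have := minDist_le C; omega
  have hn8' : (8 : ℝ) ≤ n := by exact_mod_cast hn8
  have hd8 : (8 : ℝ) ≤ minDist C := by
    have : 8 ≤ minDist C := by omega
    exact_mod_cast this
  have hx0 : 0 < (n : ℝ) ^ (-(1 / 4) : ℝ) := Real.rpow_pos_of_pos (by linarith) _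
  have hx1 : (n : ℝ) ^ (-(1 / 4) : ℝ) ≤ 1 :=
    Real.rpow_le_one_of_one_le_of_nonpos (by linarith) (by norm_num)
  have hx4 : n * ((n : ℝ) ^ (-(1 / 4) : ℝ)) ^ 4 = 1 := by
    rw [← Real.rpow_natCast, ← Real.rpow_mul (by linarith)]
    norm_num
    rw [Real.rpow_neg_one, mul_inv_cancel₀ (by linarith)]
  set x := (n : ℝ) ^ (-(1 / 4) : ℝ)
  obtain ⟨t, rfl⟩ : ∃ t, p = t + x := ⟨p - x, by ring⟩
  rw [add_sub_cancel_right] at hp hnoise ⊢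
  have ht0 : 0 ≤ t := by linarith
  have ht1 : t ≤ 1 := hp.trans (by simp)
  have hL : 1 ≤ L := hlist.one_le (by linarith)
  have hs : √(minDist C / Fintype.card F : ℝ) / Fintype.card F =
      √(minDist C : ℝ) / (Fintype.card F : ℝ) ^ (3 / 2 : ℝ) := by
    rw [Real.sqrt_div (by linarith), div_div, show (3 / 2 : ℝ) = 1 / 2 + 1 by norm_num,
      Real.rpow_add (by linarith), Real.rpow_one, Real.sqrt_eq_rpow (Fintype.card F : ℝ)]
  have hsd : √(minDist C : ℝ) / (Fintype.card F : ℝ) ^ (3 / 2 : ℝ) ≤ minDist C / 2 := by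
    have h1 : (1 : ℝ) ≤ (Fintype.card F : ℝ) ^ (3 / 2 : ℝ) :=
      Real.one_le_rpow (by linarith) (by norm_num)
    refine (div_le_self (Real.sqrt_nonneg _) h1).trans ?_
    rw [Real.sqrt_le_left (by linarith)]
    nlinarith
  have hs0 : 0 ≤ √(minDist C : ℝ) / (Fintype.card F : ℝ) ^ (3 / 2 : ℝ) := by positivity
  have hode := fun r h0 h1 => exists_hasDerivAt_strictCell C (t := r) h0 h1
  rw [hs] at hode
  set s := √(minDist C : ℝ) / (Fintype.card F : ℝ) ^ (3 / 2 : ℝ)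
  set κ := (1 - (t + x)) / 4 * s with hκ
  set f : ℝ → ℝ := fun r => prodExpect (symbolMass r) (ind (strictCell C)) with hf
  have hf0 : ∀ r, 0 ≤ r → r ≤ 1 → 0 ≤ f r := fun r h0 h1 =>
    prodExpect_nonneg (symbolMass_nonneg h0 h1) (ind_nonneg _)
  have hf1 : ∀ r, 0 ≤ r → r ≤ 1 → f r ≤ 1 := fun r h0 h1 =>
    prodExpect_ind_le_one (symbolMass_nonneg h0 h1) (sum_symbolMass r) _
  have hfprob : f (t - δ) ≤ noisyProb (t - δ) fun z => D ((c : Fin n → F) + z) = c := by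
    rw [noisyProb_eq_prodExpect]
    exact prodExpect_mono (symbolMass_nonneg hnoise (by linarith))
      (ind_mono fun z hz => hD.apply_add_eq hz c)
  refine le_trans ?_ hfprob
  have hlog : 0 ≤ Real.log (2 * L) := Real.log_nonneg (by linarith)
  -- In the first case the claimed lower bound is at most zero. In the second, `log (2 * L) < κ * δ`
  -- pays for the erasures and for the constants.
  rcases le_or_gt (κ * δ) (Real.log (2 * L)) with htriv | hlarge
  · have h1 : Real.exp (κ * δ) ≤ 2 * L := (Real.le_log_iff_exp_le (by linarith)).1 htriv
    have h2 : 1 ≤ 2 * L * Real.exp (-(κ * δ)) := by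
      rw [Real.exp_neg, ← div_eq_mul_inv, one_le_div (Real.exp_pos _)]
      exact h1
    linarith [hf0 (t - δ) hnoise (by linarith)]
  · have hκs : κ ≤ s / 4 := by
      rw [hκ]
      nlinarith
    have hκδ : κ * δ ≤ s / 4 * δ := by gcongr
    -- the loss in the noise rate that is spent on breaking ties
    obtain ⟨θ, hθ⟩ : ∃ θ, θ * minDist C = 2 * Real.log (2 * L) :=
      ⟨2 * Real.log (2 * L) / minDist C, div_mul_cancel₀ _ (by linarith)⟩
    have hθ0 : 0 ≤ θ := by
      by_contra h
      nlinarith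
    -- Here `θ * d = 2 * log (2 * L) < 2 * κ * δ ≤ s * δ / 2 ≤ d * δ / 4`, so at least three
    -- quarters of `δ` remain for the integration.
    have hθδ : θ ≤ δ / 4 := by
      have h2 : θ * minDist C ≤ δ / 4 * minDist C := by
        nlinarith [mul_le_mul_of_nonneg_right hsd hδ.le]
      exact le_of_mul_le_mul_right h2 (by linarith)
    have htθ : t * θ ≤ δ / 4 := (mul_le_of_le_one_left hθ0 ht1).trans hθδ
    have hstart : 1 / (4 * L) ≤ f (t * (1 - θ)) := by
      have h1 := half_le_prodExpect_ball (F := F) ht0 ht1 hx0 hx1 hx4 hn8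
      have h2 := prodExpect_ball_le hlist hD ht0 hp
      have h3 := half_mul_le_prodExpect_strictCell hlist hL hθ0 (by linarith) hθ.ge ht0 ht1
      rw [div_le_iff₀ (by linarith)]
      change _ ≤ f (t * (1 - θ)) at h3
      nlinarith
    have hfb : 0 < f (t * (1 - θ)) := lt_of_lt_of_le (by positivity) hstart
    have hlen : 3 / 4 * δ ≤ t * (1 - θ) - (t - δ) := by linarith
    have htb : t * (1 - θ) ≤ 1 := by nlinarith
    have hfin := one_sub_le_of_logistic (f := f) (κ := 4 / 5 * s) (a := t - δ)
      (b := t * (1 - θ)) (by linarith) (by positivity)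
      (fun r hr => hode r (hnoise.trans hr.1) (hr.2.trans htb))
      (fun r hr => hf0 r (hnoise.trans hr.1) (hr.2.trans htb))
      (fun r hr => hf1 r (hnoise.trans hr.1) (hr.2.trans htb)) hfb
    have hinv : 1 / f (t * (1 - θ)) ≤ 4 * L := by
      rw [div_le_iff₀ hfb]
      rwa [div_le_iff₀ (by linarith), mul_comm] at hstart
    -- The exponent is at least `3/5 * s * δ`, while `log 2 + κ * δ ≤ 2 * κ * δ ≤ s * δ / 2`. The
    -- factor 1/2 gained turns `4 * L` into `2 * L`.
    have hexp : Real.exp (-(4 / 5 * s * (t * (1 - θ) - (t - δ)))) ≤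
        1 / 2 * Real.exp (-(κ * δ)) := by
      have h1 : 4 / 5 * s * (3 / 4 * δ) ≤ 4 / 5 * s * (t * (1 - θ) - (t - δ)) := by gcongr
      have h2 : Real.log 2 ≤ Real.log (2 * L) := Real.log_le_log (by norm_num) (by linarith)
      calc _ ≤ Real.exp (-Real.log 2 + -(κ * δ)) := by
            gcongr
            nlinarith
        _ = _ := by rw [Real.exp_add, Real.exp_neg, Real.exp_log (by norm_num), one_div]
    have hfinal : 1 / f (t * (1 - θ)) * Real.exp (-(4 / 5 * s * (t * (1 - θ) - (t - δ)))) ≤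
        4 * L * (1 / 2 * Real.exp (-(κ * δ))) := by gcongr
    linarith
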